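/- Let $G$ be a finite simple graph drawn in the plane without crossings, with weights $w(e)$ in a commutative ring (for instance real numbers) on its edges. Let $a,b,c,d$ be four distinct vertices of $G$ appearing in this cyclic order on a face $F$ of $G$ (that is, there is a closed topological disc with interior contained in $F$ that has $a,b,c,d$ on its boundary circle in this cyclic order), and let $S$ be a set of vertices of $F$ with $S\cap\{a,b,c,d\}=\emptyset$. For a set $X$ of vertices let $G\setminus X$ be the graph obtained from $G$ by deleting $X$. For $X\subseteq\{a,b,c,d\}$ let $\operatorname{M}_f(G\setminus X)$ be the sum of the weights of all matchings of $G\setminus X$ in which every vertex not in $S$ is matched, while the vertices in $S$ may or may not be matched; the weight of a matching is the product of the weights of its edges. Say that $S$ is $a,c$-separated if there are no mutually (vertex-)disjoint paths $P_1,P_2,P_3$ in $G$ such that $P_1$ connects $a$ to $c$, $P_2$ connects $b$ to some vertex of $S$, and $P_3$ connects $d$ to some other vertex of $S$; and $b,d$-separated if there are no mutually disjoint paths $P_1,P_2,P_3$ in $G$ such that $P_1$ connects $b$ to $d$, $P_2$ connects $c$ to some vertex of $S$, and $P_3$ connects $a$ to some other vertex of $S$. Suppose that $S$ is both $a,c$-separated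 and $b,d$-separated. Then $$\operatorname{M}_f(G)\operatorname{M}_f(G\setminus\{a,b,c,d\})+\operatorname{M}_f(G\setminus\{b,d\})\operatorname{M}_f(G\setminus\{a,c\})=\operatorname{M}_f(G\setminus\{a,d\})\operatorname{M}_f(G\setminus\{b,c\})+\operatorname{M}_f(G\setminus\{a,b\})\operatorname{M}_f(G\setminus\{c,d\})$$ and $$\operatorname{M}_f(G\setminus\{b\})\operatorname{M}_f(G\setminus\{a,c,d\})+\operatorname{M}_f(G\setminus\{d\})\operatorname{M}_f(G\setminus\{a,b,c\})=\operatorname{M}_f(G\setminus\{a\})\operatorname{M}_f(G\setminus\{b,c,d\})+\operatorname{M}_f(G\setminus\{a,b,d\})\operatorname{M}_f(G\setminus\{c\}).$$ In particular, if $S=\emptyset$, both identities hold with $\operatorname{M}_f$ replaced by $\operatorname{M}$, where $\operatorname{M}(H)$ is the total weight of the perfect matchings of $H$. -/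

import Mathlib

namespace FreeBoundary

/-- A drawing of the graph `G` in the plane without crossings: vertices are distinct points, every
edge is a simple arc between its endpoints (stored once for each of its two directions), an arc
contains no vertices except its endpoints, and the arcs of two different edges meet only at
vertices. -/
structure PlaneDrawing {V : Type*} (G : SimpleGraph V) where
  pos : V → ℂ
  pos_injective : Function.Injective pos
  arc : ∀ e : G.Dart, Path (pos e.fst) (pos e.snd)
  arc_injective : ∀ e : G.Dart, Function.Injective (arc e)
  arc_symm : ∀ e : G.Dart, arc e.symm = (arc e).symm
  arc_vertex : ∀ (e : G.Dart) (t : unitInterval) (v : V), arc e t = pos v → v = e.fst ∨ v = e.snd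
  arc_inter : ∀ (e f : G.Dart) (s t : unitInterval), e.edge ≠ f.edge → arc e s = arc f t →
    ∃ v : V, arc e s = pos v

namespace PlaneDrawing

variable {V : Type*} {G : SimpleGraph V} (D : PlaneDrawing G)

/-- The set of points of the plane covered by the drawing. -/
def carrier : Set ℂ := Set.range D.pos ∪ ⋃ e : G.Dart, Set.range (D.arc e)

/-- A face is a connected component of the complement of the drawing. -/
def IsFace (F : Set ℂ) : Prop :=
  ∃ z ∈ D.carrierᶜ, F = connectedComponentIn D.carrierᶜ z

/-- The vertex `v` lies on (the boundary of) the face `F`. -/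
def OnFace (F : Set ℂ) (v : V) : Prop := D.pos v ∈ frontier F

/-- The vertices `a, b, c, d` appear in this cyclic order (in one of the two senses of rotation) on
the face `F`: a topological closed disc with interior inside `F` has them in this cyclic order on
its boundary circle. This makes sense also if the boundary of `F` is not connected, or if
it runs several times through some vertex (any occurrence of the vertex may then be used). -/
def CyclicOnFace (F : Set ℂ) (a b c d : V) : Prop :=
  ∃ h : ℂ → ℂ, ContinuousOn h (Metric.closedBall 0 1) ∧ Set.InjOn h (Metric.closedBall 0 1) ∧
    h '' Metric.ball 0 1 ⊆ F ∧
    h 1 = D.pos a ∧ h Complex.I = D.pos b ∧ h (-1) = D.pos c ∧ h (-Complex.I) = D.pos d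

end PlaneDrawing

/-- `S` is `a,c`-separated, where `a, b, c, d` are given in cyclic order: there are no mutually
disjoint paths from `a` to `c`, from `b` to a vertex of `S`, and from `d` to another vertex
of `S`. Since `b, c, d, a` is the same cyclic order, `S` is `b,d`-separated if
`IsSeparated G S b c d a`. -/
def IsSeparated {V : Type*} (G : SimpleGraph V) (S : Set V) (a b c d : V) : Prop :=
  ¬ ∃ s ∈ S, ∃ t ∈ S, s ≠ t ∧ ∃ (P₁ : G.Path a c) (P₂ : G.Path b s) (P₃ : G.Path d t),
    P₁.1.support.Disjoint P₂.1.support ∧ P₁.1.support.Disjoint P₃.1.support ∧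
      P₂.1.support.Disjoint P₃.1.support

/-- The weight of a matching: the product of the weights of its edges. -/
noncomputable def matchingWeight {V R : Type*} [CommRing R] {G : SimpleGraph V} (w : Sym2 V → R)
    (M : G.Subgraph) : R :=
  ∏ᶠ e ∈ M.edgeSet, w e

/-- The free boundary matching sum of a subgraph `H` of `G`: the total weight of the matchings of
`H` in which all vertices outside `S` are matched (those in `S` may or may not be matched). -/
noncomputable def freeMatchingSum {V R : Type*} [CommRing R] {G : SimpleGraph V} (w : Sym2 V → R)
    (S : Set V) (H : G.Subgraph) : R :=
  ∑ᶠ M ∈ {M : G.Subgraph | M ≤ H ∧ M.IsMatching ∧ H.verts \ S ⊆ M.verts}, matchingWeight w M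

/-- The total weight of the perfect matchings of a subgraph `H` of `G`. -/
noncomputable def perfectMatchingSum {V R : Type*} [CommRing R] {G : SimpleGraph V}
    (w : Sym2 V → R) (H : G.Subgraph) : R :=
  ∑ᶠ M ∈ {M : G.Subgraph | M ≤ H ∧ M.IsMatching ∧ M.verts = H.verts}, matchingWeight w M

/-- The graph `G` with the vertices in `X` (and all edges at them) removed. -/
def del {V : Type*} (G : SimpleGraph V) (X : Set V) : G.Subgraph :=
  (⊤ : G.Subgraph).deleteVerts X

end FreeBoundary

namespace FreeBoundary

/-! ### Continuous logarithms and their increments. -/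

open Complex Topology

/-! Each product in the identities sums over pairs (M, N) of matchings that cover each of a, b, c, d
exactly once between them and every other vertex outside S twice. A component of the superposition
of M and N has total defect (missing coverings) 0 or 2, see `even_sum_defect_and_le_two`. If a and c
shared a component, it would have no room for b or d. Either b and d would then be joined away from
it, which planarity forbids, or each would be joined to its own vertex of S, which separation
forbids (`not_reachable_opposite`). By symmetry b and d are also in different components. So some
union of components contains a, exactly one of b and d, and not c. Exchanging M and N on it is a
weight-preserving involution between the pairs of the two sides (`pairSum_flip`).

Planarity enters through `curves_intersect_of_crossing`: for a disc parametrized by h, the winding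
of h(x) - h(iy) along the boundary of the square [-1, 1]² is nonzero, because it deforms to that of
an odd map. Disjoint crossing curves outside the disc would force it to be zero. -/

/-- The increment over `[0, 1]` of a continuous logarithm of `f`. -/
noncomputable def logIncrement (f : ℝ → ℂ) : ℂ :=
  open Classical in
  if h : ∃ g : ℝ → ℂ, Continuous g ∧ ∀ u, exp (g u) = f u then h.choose 1 - h.choose 0 else 0

/-- Two logarithms differ by 2πi times a continuous integer-valued function, which is constant on
the line. Hence the increment does not depend on the chosen logarithm. -/
lemma exp_lift_sub_const {g g' : ℝ → ℂ} (hg : Continuous g) (hg' : Continuous g')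
    (h : ∀ u, exp (g u) = exp (g' u)) (u v : ℝ) : g u - g' u = g v - g' v := by
  have hcont : Continuous fun u => ((g u - g' u) / (2 * Real.pi * I)).re := by fun_prop
  have hint : ∀ u, ∃ n : ℤ, g u - g' u = n * (2 * Real.pi * I) := fun u => by
    obtain ⟨n, hn⟩ := Complex.exp_eq_exp_iff_exists_int.1 (h u)
    exact ⟨n, by rw [hn]; ring⟩
  choose n hn using hint
  have hne : (2 * Real.pi * I : ℂ) ≠ 0 := by simp [Real.pi_ne_zero]
  have hre : ∀ u, ((g u - g' u) / (2 * Real.pi * I)).re = n u := fun u => by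
    rw [hn, mul_div_assoc, div_self hne]; simp
  simp only [hre] at hcont
  have hn' : Continuous n := Int.isClosedEmbedding_coe_real.isEmbedding.continuous_iff.2 hcont
  rw [hn u, hn v, PreconnectedSpace.constant inferInstance hn' (x := u) (y := v)]

lemma logIncrement_eq {f g : ℝ → ℂ} (hg : Continuous g) (h : ∀ u, exp (g u) = f u) :
    logIncrement f = g 1 - g 0 := by
  have hex : ∃ g : ℝ → ℂ, Continuous g ∧ ∀ u, exp (g u) = f u := ⟨g, hg, h⟩
  rw [logIncrement, dif_pos hex]
  have := exp_lift_sub_const hex.choose_spec.1 hg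
    (fun u => (hex.choose_spec.2 u).trans (h u).symm) 1 0
  linear_combination this

/-- The exponential is a covering of the punctured plane, and ℝ × ℝ is simply connected. -/
lemma exists_log_of_continuous {H : ℝ × ℝ → ℂ} (hH : Continuous H) (h0 : ∀ p, H p ≠ 0) :
    ∃ L : ℝ × ℝ → ℂ, Continuous L ∧ ∀ p, exp (L p) = H p := by
  obtain ⟨F, ⟨-, hF⟩, -⟩ := isCoveringMapOn_exp.existsUnique_continuousMap_lifts
    (⟨H, hH⟩ : C(ℝ × ℝ, ℂ)) (a₀ := (0, 0)) (exp_log (h0 _)) (fun a => h0 a)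
  exact ⟨F, F.continuous, fun p => congrFun hF p⟩

/-- The increments of the logarithm along the sides of the unit square add up to zero. -/
lemma logIncrement_square {H : ℝ × ℝ → ℂ} (hH : Continuous H) (h0 : ∀ p, H p ≠ 0) :
    logIncrement (fun u => H (0, u)) + logIncrement (fun s => H (s, 1)) =
      logIncrement (fun s => H (s, 0)) + logIncrement (fun u => H (1, u)) := by
  obtain ⟨L, hL, hexp⟩ := exists_log_of_continuous hH h0
  rw [logIncrement_eq (g := fun u => L (0, u)) (by fun_prop) (fun u => hexp _),
    logIncrement_eq (g := fun u => L (u, 1)) (by fun_prop) (fun u => hexp _),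
    logIncrement_eq (g := fun u => L (u, 0)) (by fun_prop) (fun u => hexp _),
    logIncrement_eq (g := fun u => L (1, u)) (by fun_prop) (fun u => hexp _)]
  ring

lemma exists_log_of_continuous_real {f : ℝ → ℂ} (hf : Continuous f) (h0 : ∀ u, f u ≠ 0) :
    ∃ g : ℝ → ℂ, Continuous g ∧ ∀ u, exp (g u) = f u := by
  obtain ⟨L, hL, hexp⟩ := exists_log_of_continuous (H := fun p => f p.1) (by fun_prop)
    (fun p => h0 _)
  exact ⟨fun u => L (u, 0), by fun_prop, fun u => hexp _⟩

lemma exp_logIncrement {f : ℝ → ℂ} (hf : Continuous f) (h0 : ∀ u, f u ≠ 0) :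
    exp (logIncrement f) = f 1 / f 0 := by
  obtain ⟨g, hg, hexp⟩ := exists_log_of_continuous_real hf h0
  rw [logIncrement_eq hg hexp, exp_sub, hexp, hexp]

lemma logIncrement_neg_reverse {f : ℝ → ℂ} (hf : Continuous f) (h0 : ∀ u, f u ≠ 0) :
    logIncrement (fun u => -f (1 - u)) = -logIncrement f := by
  obtain ⟨g, hg, hexp⟩ := exists_log_of_continuous_real hf h0
  rw [logIncrement_eq hg hexp, logIncrement_eq (g := fun u => g (1 - u) + Real.pi * I)
    (by fun_prop) (fun u => by rw [exp_add, hexp, exp_pi_mul_I]; ring)]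
  simp

/-! ### Winding of differences on a disc, and crossing curves. -/

/-- The retraction of the line to `[0, 1]`. -/
noncomputable def clamp (u : ℝ) : ℝ := max 0 (min 1 u)

@[fun_prop] lemma continuous_clamp : Continuous clamp := by unfold clamp; fun_prop
lemma clamp_nonneg (u : ℝ) : 0 ≤ clamp u := le_max_left _ _
lemma clamp_le_one (u : ℝ) : clamp u ≤ 1 := by simp [clamp]
@[simp] lemma clamp_zero : clamp 0 = 0 := by simp [clamp]
@[simp] lemma clamp_one : clamp 1 = 1 := by simp [clamp]
lemma clamp_one_sub (u : ℝ) : clamp (1 - u) = 1 - clamp u := by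
  unfold clamp
  rcases le_total u 0 with h | h <;> rcases le_total u 1 with h' | h' <;>
    simp [*]
  all_goals linarith

/-- The coordinate on `[-1, 1]` attached to `u`. -/
noncomputable def sideCoord (u : ℝ) : ℝ := 2 * clamp u - 1

@[fun_prop] lemma continuous_sideCoord : Continuous sideCoord := by unfold sideCoord; fun_prop
lemma abs_sideCoord_le (u : ℝ) : |sideCoord u| ≤ 1 := by
  have := clamp_nonneg u
  have := clamp_le_one u
  unfold sideCoord
  exact abs_le.2 ⟨by linarith, by linarith⟩
@[simp] lemma sideCoord_zero : sideCoord 0 = -1 := by norm_num [sideCoord]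
@[simp] lemma sideCoord_one : sideCoord 1 = 1 := by norm_num [sideCoord]
lemma sideCoord_one_sub (u : ℝ) : sideCoord (1 - u) = -sideCoord u := by
  simp only [sideCoord, clamp_one_sub]; ring

/-- The difference of the values of `h` at two points that, for `t` running from `0` to `1`, move
from `x` and `y * I` to two opposite points, keeping their difference up to a positive factor. -/
noncomputable def crossDiff (h : ℂ → ℂ) (t x y : ℝ) : ℂ :=
  h ((1 + t : ℝ)⁻¹ • ((x : ℂ) - t * (y * I))) - h ((1 + t : ℝ)⁻¹ • ((y : ℂ) * I - t * x))

lemma mem_closedBall_of_convex {t : ℝ} (ht : 0 ≤ t) {z w : ℂ} (hz : ‖z‖ ≤ 1) (hw : ‖w‖ ≤ 1) :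
    (1 + t : ℝ)⁻¹ • (z - t * w) ∈ Metric.closedBall (0 : ℂ) 1 := by
  have h1 : (0 : ℝ) < 1 + t := by linarith
  rw [mem_closedBall_zero_iff, norm_smul, Real.norm_of_nonneg (by positivity),
    inv_mul_le_iff₀ h1, mul_one]
  calc ‖z - t * w‖ ≤ ‖z‖ + ‖(t : ℂ) * w‖ := norm_sub_le _ _
    _ = ‖z‖ + t * ‖w‖ := by rw [norm_mul, norm_real, Real.norm_of_nonneg ht]
    _ ≤ 1 + t := by nlinarith

section crossDiff

variable {h : ℂ → ℂ}

lemma norm_ofReal_le {x : ℝ} (hx : |x| ≤ 1) : ‖(x : ℂ)‖ ≤ 1 := by simpa using hx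

lemma norm_ofReal_mul_I_le {x : ℝ} (hx : |x| ≤ 1) : ‖(x : ℂ) * I‖ ≤ 1 := by simpa using hx

lemma continuous_crossDiff (hc : ContinuousOn h (Metric.closedBall 0 1)) {X : Type*}
    [TopologicalSpace X] {t x y : X → ℝ} (ht : Continuous t) (hx : Continuous x)
    (hy : Continuous y) (ht0 : ∀ p, 0 ≤ t p) (hx1 : ∀ p, |x p| ≤ 1) (hy1 : ∀ p, |y p| ≤ 1) :
    Continuous fun p => crossDiff h (t p) (x p) (y p) := by
  have hne : ∀ p, 1 + t p ≠ 0 := fun p => by linarith [ht0 p]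
  unfold crossDiff
  refine Continuous.sub (hc.comp_continuous ?_ fun p => ?_) (hc.comp_continuous ?_ fun p => ?_)
  · exact Continuous.smul ((continuous_const.add ht).inv₀ hne) (by fun_prop)
  · exact mem_closedBall_of_convex (ht0 p) (norm_ofReal_le (hx1 p)) (norm_ofReal_mul_I_le (hy1 p))
  · exact Continuous.smul ((continuous_const.add ht).inv₀ hne) (by fun_prop)
  · exact mem_closedBall_of_convex (ht0 p) (norm_ofReal_mul_I_le (hy1 p)) (norm_ofReal_le (hx1 p))

/-- The two arguments of `h` always differ by x - iy, so injectivity applies away from the origin.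
-/
lemma crossDiff_ne_zero (hi : Set.InjOn h (Metric.closedBall 0 1)) {t x y : ℝ} (ht : 0 ≤ t)
    (hx : |x| ≤ 1) (hy : |y| ≤ 1) (hxy : x ≠ 0 ∨ y ≠ 0) : crossDiff h t x y ≠ 0 := by
  intro h0
  have heq := hi
    (mem_closedBall_of_convex ht (norm_ofReal_le hx) (norm_ofReal_mul_I_le hy))
    (mem_closedBall_of_convex ht (norm_ofReal_mul_I_le hy) (norm_ofReal_le hx))
    (sub_eq_zero.1 h0)
  have h1 : (1 + t : ℝ) ≠ 0 := by linarith
  have heq' := smul_right_injective ℂ (inv_ne_zero h1) heq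
  have hre := congrArg Complex.re heq'
  have him := congrArg Complex.im heq'
  simp at hre him
  rcases hxy with hx0 | hy0
  · exact mul_ne_zero h1 hx0 (by linarith)
  · exact mul_ne_zero h1 hy0 (by linarith)

lemma crossDiff_zero (h : ℂ → ℂ) (x y : ℝ) : crossDiff h 0 x y = h x - h (y * I) := by
  simp [crossDiff]

lemma crossDiff_one_neg (h : ℂ → ℂ) (x y : ℝ) : crossDiff h 1 (-x) (-y) = -crossDiff h 1 x y := by
  simp only [crossDiff, ofReal_neg, ofReal_one, neg_sub]
  congr 3 <;> ring

/-- The winding number of `h x - h (y * I)` along the boundary of the square does not vanish. -/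
lemma crossDiff_winding_ne_zero (hc : ContinuousOn h (Metric.closedBall 0 1))
    (hi : Set.InjOn h (Metric.closedBall 0 1)) :
    logIncrement (fun u => h (sideCoord u) - h (-I))
      + logIncrement (fun u => h 1 - h (sideCoord u * I))
      - logIncrement (fun u => h (sideCoord u) - h I)
      - logIncrement (fun u => h (-1) - h (sideCoord u * I)) ≠ 0 := by
  have one : |(1 : ℝ)| ≤ 1 := by simp
  have negone : |(-1 : ℝ)| ≤ 1 := by simp
  -- Deforms a horizontal side from t = 0 to t = 1; the increments along the tracks of the corners
  -- cancel when the four sides are combined.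
  have horiz : ∀ y : ℝ, |y| ≤ 1 → y ≠ 0 → _ := fun y hy hy0 =>
    logIncrement_square (H := fun p => crossDiff h (clamp p.1) (sideCoord p.2) y)
      (continuous_crossDiff hc (by fun_prop) (by fun_prop) (by fun_prop)
        (fun _ => clamp_nonneg _) (fun _ => abs_sideCoord_le _) fun _ => hy)
      (fun _ => crossDiff_ne_zero hi (clamp_nonneg _) (abs_sideCoord_le _) hy (Or.inr hy0))
  have vert : ∀ x : ℝ, |x| ≤ 1 → x ≠ 0 → _ := fun x hx hx0 =>
    logIncrement_square (H := fun p => crossDiff h (clamp p.1) x (sideCoord p.2))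
      (continuous_crossDiff hc (by fun_prop) (by fun_prop) (by fun_prop)
        (fun _ => clamp_nonneg _) (fun _ => hx) fun _ => abs_sideCoord_le _)
      (fun _ => crossDiff_ne_zero hi (clamp_nonneg _) hx (abs_sideCoord_le _) (Or.inl hx0))
  have hB := horiz (-1) negone (by norm_num)
  have hT := horiz 1 one (by norm_num)
  have hR := vert 1 one (by norm_num)
  have hL := vert (-1) negone (by norm_num)
  have cB : Continuous fun u => crossDiff h 1 (sideCoord u) (-1) :=
    continuous_crossDiff hc (by fun_prop) (by fun_prop) (by fun_prop) (fun _ => zero_le_one)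
      (fun _ => abs_sideCoord_le _) fun _ => negone
  have nB : ∀ u, crossDiff h 1 (sideCoord u) (-1) ≠ 0 := fun u =>
    crossDiff_ne_zero hi zero_le_one (abs_sideCoord_le _) negone (Or.inr (by norm_num))
  have cR : Continuous fun u => crossDiff h 1 1 (sideCoord u) :=
    continuous_crossDiff hc (by fun_prop) (by fun_prop) (by fun_prop) (fun _ => zero_le_one)
      (fun _ => one) fun _ => abs_sideCoord_le _
  have nR : ∀ u, crossDiff h 1 1 (sideCoord u) ≠ 0 := fun u =>
    crossDiff_ne_zero hi zero_le_one one (abs_sideCoord_le _) (Or.inl (by norm_num))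
  have eT : logIncrement (fun u => crossDiff h 1 (sideCoord u) 1) =
      -logIncrement (fun u => crossDiff h 1 (sideCoord u) (-1)) := by
    rw [← logIncrement_neg_reverse cB nB]
    congr 1; ext u
    rw [sideCoord_one_sub, ← crossDiff_one_neg, neg_neg, neg_neg]
  have eL : logIncrement (fun u => crossDiff h 1 (-1) (sideCoord u)) =
      -logIncrement (fun u => crossDiff h 1 1 (sideCoord u)) := by
    rw [← logIncrement_neg_reverse cR nR]
    congr 1; ext u
    rw [sideCoord_one_sub, ← crossDiff_one_neg, neg_neg]
  have exB := exp_logIncrement cB nB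
  have exR := exp_logIncrement cR nR
  have n1 := nB 0
  have n2 := nB 1
  simp only [sideCoord_zero, sideCoord_one] at exB exR n1 n2
  -- Bottom and right side together lead from a corner to the opposite one, where the odd map at t =
  -- 1 takes the negative value.
  have hexp : exp (logIncrement (fun u => crossDiff h 1 (sideCoord u) (-1)) +
      logIncrement (fun u => crossDiff h 1 1 (sideCoord u))) = -1 := by
    have := crossDiff_one_neg h 1 1
    rw [exp_add, exB, exR]
    rw [this] at n1 ⊢
    have := neg_ne_zero.1 n1
    field_simp
  simp only [clamp_zero, clamp_one, crossDiff_zero, sideCoord_zero, sideCoord_one, ofReal_neg,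
    ofReal_one, one_mul, neg_mul] at hB hT hR hL
  rw [eT] at hT
  rw [eL] at hL
  intro h0
  -- By oddness the whole boundary at t = 1 contributes twice this half, so zero winding would make
  -- the half vanish and its exponential equal 1.
  have : logIncrement (fun u => crossDiff h 1 (sideCoord u) (-1)) +
      logIncrement (fun u => crossDiff h 1 1 (sideCoord u)) = 0 := by
    linear_combination (h0 - hB + hT - hR + hL) / 2
  rw [this, exp_zero] at hexp
  norm_num at hexp

end crossDiff

/-- Two curves outside an open topological disc which join opposite points on its boundary in
crossing position intersect. -/
theorem curves_intersect_of_crossing {h : ℂ → ℂ} (hc : ContinuousOn h (Metric.closedBall 0 1))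
    (hi : Set.InjOn h (Metric.closedBall 0 1)) (γ : Path (h 1) (h (-1)))
    (δ : Path (h I) (h (-I))) (hγ : Disjoint (Set.range γ) (h '' Metric.ball 0 1))
    (hδ : Disjoint (Set.range δ) (h '' Metric.ball 0 1)) :
    ¬ Disjoint (Set.range γ) (Set.range δ) := by
  intro hdisj
  have hend : ∀ u : ℝ, sideCoord u = 1 ∨ sideCoord u = -1 ∨ |sideCoord u| < 1 := fun u => by
    rcases (abs_sideCoord_le u).lt_or_eq with hlt | heq
    · exact Or.inr (Or.inr hlt)
    · rcases eq_or_eq_neg_of_abs_eq heq with h | h <;> simp [h]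
  have mγ : ∀ s, γ.extend s ∈ Set.range γ := fun s => by
    rw [← γ.extend_range]; exact Set.mem_range_self s
  have mδ : ∀ s, δ.extend s ∈ Set.range δ := fun s => by
    rw [← δ.extend_range]; exact Set.mem_range_self s
  have cH : Continuous fun u => h (sideCoord u) := hc.comp_continuous (by fun_prop) fun u => by
    simpa using abs_sideCoord_le u
  have cV : Continuous fun u => h (sideCoord u * I) := hc.comp_continuous (by fun_prop) fun u => by
    simpa using abs_sideCoord_le u
  -- The interior of the vertical diameter lies in the open disc, which `γ` avoids; its two ends lie
  -- on `δ`.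
  have nA : ∀ s u, γ.extend s - h (sideCoord u * I) ≠ 0 := fun s u h0 => by
    rw [sub_eq_zero] at h0
    have := mγ s
    rw [h0] at this
    rcases hend u with h1 | h1 | h1
    · rw [h1] at this
      exact Set.disjoint_left.1 hdisj this ⟨0, by simp⟩
    · rw [h1] at this
      exact Set.disjoint_left.1 hdisj this ⟨1, by simp⟩
    · exact Set.disjoint_left.1 hγ this ⟨_, by simpa using h1, rfl⟩
  have nB : ∀ s u, h (sideCoord u) - δ.extend s ≠ 0 := fun s u h0 => by
    rw [sub_eq_zero] at h0
    have := mδ s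
    rw [← h0] at this
    rcases hend u with h1 | h1 | h1
    · rw [h1] at this
      exact Set.disjoint_right.1 hdisj this ⟨0, by simp⟩
    · rw [h1] at this
      exact Set.disjoint_right.1 hdisj this ⟨1, by simp⟩
    · exact Set.disjoint_left.1 hδ this ⟨_, by simpa using h1, rfl⟩
  have nC : ∀ s t, γ.extend s - δ.extend t ≠ 0 := fun s t h0 =>
    Set.disjoint_left.1 hdisj (mγ s) (sub_eq_zero.1 h0 ▸ mδ t)
  -- Three squares: `γ` against the vertical diameter, the horizontal diameter against `δ`, and `γ`
  -- against `δ`. Their relations combine to zero winding.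
  have hA := logIncrement_square (H := fun p => γ.extend p.1 - h (sideCoord p.2 * I))
    ((γ.continuous_extend.comp continuous_fst).sub (cV.comp continuous_snd)) fun p => nA _ _
  have hB := logIncrement_square (H := fun p => h (sideCoord p.2) - δ.extend p.1)
    ((cH.comp continuous_snd).sub (δ.continuous_extend.comp continuous_fst)) fun p => nB _ _
  have hC := logIncrement_square (H := fun p => γ.extend p.1 - δ.extend p.2)
    ((γ.continuous_extend.comp continuous_fst).sub (δ.continuous_extend.comp continuous_snd))
    fun p => nC _ _
  simp only [Path.extend_zero, Path.extend_one, sideCoord_zero, sideCoord_one, ofReal_one,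
    ofReal_neg, one_mul, neg_mul] at hA hB hC
  exact crossDiff_winding_ne_zero hc hi (by linear_combination hA - hB + hC)

/-! ### Walks in a plane drawing as curves. -/

namespace PlaneDrawing

variable {V : Type*} {G : SimpleGraph V} (D : PlaneDrawing G)

/-- The set of points of the plane covered by a walk. -/
def walkCarrier {u v : V} (p : G.Walk u v) : Set ℂ :=
  {z | (∃ x ∈ p.support, z = D.pos x) ∨ ∃ e ∈ p.darts, z ∈ Set.range (D.arc e)}

lemma walkCarrier_subset {u v : V} (p : G.Walk u v) : D.walkCarrier p ⊆ D.carrier := by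
  rintro z (⟨x, -, rfl⟩ | ⟨e, -, hz⟩)
  · exact Or.inl ⟨x, rfl⟩
  · exact Or.inr (Set.mem_iUnion.2 ⟨e, hz⟩)

lemma exists_path_in_walkCarrier {u v : V} (p : G.Walk u v) :
    ∃ γ : Path (D.pos u) (D.pos v), Set.range γ ⊆ D.walkCarrier p := by
  induction p with
  | nil => exact ⟨Path.refl _, by rintro z ⟨t, rfl⟩; exact Or.inl ⟨_, by simp, rfl⟩⟩
  | @cons u v w h p ih =>
    obtain ⟨γ, hγ⟩ := ih
    refine ⟨(D.arc ⟨(u, v), h⟩).trans γ, ?_⟩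
    rw [Path.trans_range]
    rintro z (hz | hz)
    · exact Or.inr ⟨⟨(u, v), h⟩, by simp, hz⟩
    · rcases hγ hz with ⟨x, hx, rfl⟩ | ⟨e, he, hz⟩
      · exact Or.inl ⟨x, by simp [hx], rfl⟩
      · exact Or.inr ⟨e, by simp [he], hz⟩

lemma disjoint_walkCarrier {u v u' v' : V} (p : G.Walk u v) (q : G.Walk u' v')
    (h : p.support.Disjoint q.support) : Disjoint (D.walkCarrier p) (D.walkCarrier q) := by
  have dart_mem : ∀ {u v : V} (p : G.Walk u v), ∀ e ∈ p.darts, ∀ x : V, x = e.fst ∨ x = e.snd →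
      x ∈ p.support := by
    rintro u v p e he x (rfl | rfl)
    · exact p.dart_fst_mem_support_of_mem_darts he
    · exact p.dart_snd_mem_support_of_mem_darts he
  rw [Set.disjoint_left]
  rintro z (⟨x, hx, rfl⟩ | ⟨e, he, s, rfl⟩) (⟨y, hy, hxy⟩ | ⟨f, hf, t, ht⟩)
  · exact h hx (D.pos_injective hxy ▸ hy)
  · exact h hx (dart_mem q f hf x (D.arc_vertex f t x ht))
  · exact h (dart_mem p e he y (D.arc_vertex e s y hxy)) hy
  -- Two darts of the same edge would put a common vertex on both walks.
  · have hne : e.edge ≠ f.edge := fun hef => by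
      have : e.fst ∈ f.edge := hef ▸ Sym2.mem_mk_left _ _
      exact h (dart_mem p e he _ (Or.inl rfl)) (dart_mem q f hf _ (Sym2.mem_iff.1 this))
    obtain ⟨x, hx⟩ := D.arc_inter e f s t hne ht.symm
    exact h (dart_mem p e he x (D.arc_vertex e s x hx))
      (dart_mem q f hf x (D.arc_vertex f t x (ht.trans hx)))

/-- Walks joining opposite vertices among four vertices in cyclic order on a face intersect. -/
theorem CyclicOnFace.walks_intersect {D : PlaneDrawing G} {F : Set ℂ} (hF : D.IsFace F)
    {a b c d : V} (habcd : D.CyclicOnFace F a b c d) (p : G.Walk a c) (q : G.Walk b d) :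
    ¬ p.support.Disjoint q.support := by
  intro hdisj
  obtain ⟨h, hc, hi, hball, ha, hb, hc', hd⟩ := habcd
  obtain ⟨z, -, rfl⟩ := hF
  obtain ⟨γ, hγ⟩ := D.exists_path_in_walkCarrier p
  obtain ⟨δ, hδ⟩ := D.exists_path_in_walkCarrier q
  have hout : Disjoint D.carrier (h '' Metric.ball 0 1) :=
    Set.disjoint_right.2 fun x hx => connectedComponentIn_subset _ _ (hball hx)
  refine curves_intersect_of_crossing hc hi (γ.cast ha hc') (δ.cast hb hd) ?_ ?_ ?_
  · exact hout.mono_left (hγ.trans (D.walkCarrier_subset p))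
  · exact hout.mono_left (hδ.trans (D.walkCarrier_subset q))
  · exact (D.disjoint_walkCarrier p q hdisj).mono hγ hδ

end PlaneDrawing

/-! ### Components of the superposition of two matchings. -/

open SimpleGraph Finset

section Superposition

variable {V : Type*} {G : SimpleGraph V}

/-- The superposition of two subgraphs. -/
def superpose (M N : G.Subgraph) : SimpleGraph V := M.spanningCoe ⊔ N.spanningCoe

lemma superpose_adj {M N : G.Subgraph} {x y : V} :
    (superpose M N).Adj x y ↔ M.Adj x y ∨ N.Adj x y := Iff.rfl

lemma superpose_le (M N : G.Subgraph) : superpose M N ≤ G :=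
  sup_le M.spanningCoe_le N.spanningCoe_le

/-- The number of the two subgraphs that do not contain `v`. -/
noncomputable def defect (M N : G.Subgraph) (v : V) : ℕ :=
  open Classical in (if v ∈ M.verts then 0 else 1) + (if v ∈ N.verts then 0 else 1)

lemma defect_eq_zero {M N : G.Subgraph} {v : V} :
    defect M N v = 0 ↔ v ∈ M.verts ∧ v ∈ N.verts := by
  unfold defect; split_ifs <;> simp_all

lemma defect_eq_one {M N : G.Subgraph} {v : V} :
    defect M N v = 1 ↔ (v ∈ M.verts ↔ v ∉ N.verts) := by
  unfold defect; split_ifs <;> simp_all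

/-- Partners lie in the same component, so the matching restricts to one of `C`. -/
lemma even_card_filter_verts [Fintype V] {U : SimpleGraph V} {M : G.Subgraph} (hM : M.IsMatching)
    (hU : M.spanningCoe ≤ U) (C : U.ConnectedComponent) :
    open Classical in Even (#{v | v ∈ C.supp ∧ v ∈ M.verts}) := by
  classical
  have hind : (M.induce (M.verts ∩ C.supp)).IsMatching := by
    rintro v ⟨hv, hvC⟩
    obtain ⟨w, hw, huniq⟩ := hM hv
    have hwC : w ∈ C.supp := (C.mem_supp_congr_adj (hU hw)).1 hvC
    exact ⟨w, ⟨⟨hv, hvC⟩, ⟨M.edge_vert hw.symm, hwC⟩, hw⟩, fun y hy => huniq y hy.2.2⟩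
  convert hind.even_card using 2
  ext v
  simp [and_comm]

lemma card_filter_adj_le [Fintype V] {M : G.Subgraph} (hM : M.IsMatching) (v : V) :
    open Classical in #{w | M.Adj v w} ≤ if v ∈ M.verts then 1 else 0 := by
  classical
  split_ifs with hv
  · exact card_le_one.2 fun x hx y hy =>
      hM.eq_of_adj_left (mem_filter.1 hx).2 (mem_filter.1 hy).2
  · rw [Nat.le_zero, card_eq_zero, filter_eq_empty_iff]
    exact fun w _ hw => hv (M.edge_vert hw)

/-- Each component of the superposition of two matchings has at most two ends. -/
lemma even_sum_defect_and_le_two [Fintype V] {M N : G.Subgraph} (hM : M.IsMatching)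
    (hN : N.IsMatching) (C : (superpose M N).ConnectedComponent) :
    open Classical in Even (∑ v with v ∈ C.supp, defect M N v) ∧
      ∑ v with v ∈ C.supp, defect M N v ≤ 2 := by
  classical
  set K : Finset V := {v | v ∈ C.supp} with hK
  set cov : V → ℕ := fun v => (if v ∈ M.verts then 1 else 0) + (if v ∈ N.verts then 1 else 0)
  have htotal : ∑ v ∈ K, defect M N v + ∑ v ∈ K, cov v = 2 * #K := by
    rw [← sum_add_distrib, mul_comm, ← smul_eq_mul, ← sum_const]
    refine sum_congr rfl fun v _ => ?_
    simp only [defect, cov]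
    split_ifs <;> rfl
  have heven : Even (∑ v ∈ K, cov v) := by
    have h1 := even_card_filter_verts hM (U := superpose M N) le_sup_left C
    have h2 := even_card_filter_verts hN (U := superpose M N) le_sup_right C
    simp only [cov, sum_add_distrib, sum_boole, hK, filter_filter, Nat.cast_id]
    exact h1.add h2
  have hcard : Fintype.card C = #K := Fintype.card_of_subtype K fun x => by
    simp only [hK, mem_filter, mem_univ, true_and]; rfl
  -- A connected graph on k vertices has at least k - 1 edges, and a degree is at most the number of
  -- matchings covering the vertex. With `htotal`, this bounds the total defect by 2.
  have hedges : 2 * #K ≤ ∑ v ∈ K, cov v + 2 := by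
    have h1 := C.connected_toSimpleGraph.card_vert_le_card_edgeSet_add_one
    rw [Nat.card_eq_fintype_card, Nat.card_eq_fintype_card, ← edgeFinset_card, hcard] at h1
    have h2 := C.toSimpleGraph.sum_degrees_eq_twice_card_edges
    have h3 : ∑ v, C.toSimpleGraph.degree v ≤ ∑ v ∈ K, cov v := by
      rw [sum_subtype K (p := fun x => x ∈ C)
        (fun x => by simp only [hK, mem_filter, mem_univ, true_and]; rfl) cov]
      refine sum_le_sum fun v _ => ?_
      calc C.toSimpleGraph.degree v
          = #((C.toSimpleGraph.neighborFinset v).image Subtype.val) := by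
            rw [card_image_of_injective _ Subtype.val_injective, card_neighborFinset_eq_degree]
        _ ≤ #(({w | M.Adj v w} : Finset V) ∪ ({w | N.Adj v w} : Finset V)) := by
            refine card_le_card fun w hw => ?_
            obtain ⟨x, hx, rfl⟩ := mem_image.1 hw
            rw [mem_neighborFinset] at hx
            have hx' : (superpose M N).Adj v x := hx
            simpa [superpose_adj] using hx'
        _ ≤ _ := card_union_le _ _
        _ ≤ cov v := add_le_add (card_filter_adj_le hM _) (card_filter_adj_le hN _)
    omega
  refine ⟨?_, by omega⟩
  have : Even (2 * #K) := even_two_mul _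
  rw [← htotal, Nat.even_add] at this
  exact this.2 heven

lemma even_sum_defect_and_le_two_of_reachable [Fintype V] {M N : G.Subgraph} (hM : M.IsMatching)
    (hN : N.IsMatching) (x : V) :
    open Classical in Even (∑ v with (superpose M N).Reachable x v, defect M N v) ∧
      ∑ v with (superpose M N).Reachable x v, defect M N v ≤ 2 := by
  classical
  have h := even_sum_defect_and_le_two hM hN ((superpose M N).connectedComponentMk x)
  have hmem : ∀ v, (superpose M N).Reachable x v ↔
      v ∈ ((superpose M N).connectedComponentMk x).supp := fun v => by
    rw [ConnectedComponent.mem_supp_iff, ConnectedComponent.eq, reachable_comm]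
  convert h using 3 <;> exact filter_congr fun v _ => hmem v

lemma exists_path_of_reachable {U : SimpleGraph V} (hU : U ≤ G) {x y : V} (h : U.Reachable x y) :
    ∃ p : G.Path x y, ∀ z ∈ p.1.support, U.Reachable x z := by
  classical
  obtain ⟨p, hp⟩ := h.exists_isPath
  refine ⟨⟨p.mapLe hU, hp.mapLe hU⟩, fun z hz => ?_⟩
  rw [Walk.support_mapLe_eq_support] at hz
  exact (p.takeUntil z hz).reachable

/-- In the superposition of two matchings with simple defects at `a, b, c, d` and arbitrary defects
in `S`, planarity and separation keep `a` and `c` in different components. -/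
lemma not_reachable_opposite [Finite V] {S : Set V} {a b c d : V} {M N : G.Subgraph}
    (hM : M.IsMatching) (hN : N.IsMatching)
    (hab : a ≠ b) (hac : a ≠ c) (had : a ≠ d) (hbc : b ≠ c) (hcd : c ≠ d)
    (ha : defect M N a = 1) (hb : defect M N b = 1) (hc : defect M N c = 1)
    (hd : defect M N d = 1)
    (h0 : ∀ v, v ∉ S → v ≠ a → v ≠ b → v ≠ c → v ≠ d → defect M N v = 0)
    (hplane : ∀ (p : G.Walk a c) (q : G.Walk b d), ¬ p.support.Disjoint q.support)
    (hsep : IsSeparated G S a b c d) : ¬ (superpose M N).Reachable a c := by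
  classical
  have := Fintype.ofFinite V
  intro hreach
  set U := superpose M N with hU
  have hle : U ≤ G := superpose_le M N
  -- Three vertices of defect 1 would exceed the bound 2 for the component.
  have not_third : ∀ x, a ≠ x → c ≠ x → defect M N x = 1 → ¬ U.Reachable a x := by
    intro x hax hcx hx hr
    have h2 := (even_sum_defect_and_le_two_of_reachable hM hN a).2
    have hsub : ({a, c, x} : Finset V) ⊆ ({v | U.Reachable a v} : Finset V) := by
      intro v hv
      simp only [mem_insert, mem_singleton] at hv
      rw [mem_filter]
      rcases hv with rfl | rfl | rfl
      · exact ⟨mem_univ _, .refl _⟩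
      · exact ⟨mem_univ _, hreach⟩
      · exact ⟨mem_univ _, hr⟩
    have h3 := (sum_le_sum_of_subset (f := defect M N) hsub).trans h2
    rw [sum_insert (by simp [hac, hax]), sum_insert (by simp [hcx]), sum_singleton] at h3
    omega
  -- A single defect of 1 would make the even total of the component odd.
  have other_end : ∀ x, defect M N x = 1 → ∃ y, y ≠ x ∧ U.Reachable x y ∧ defect M N y ≠ 0 := by
    intro x hx
    by_contra! hcon
    have h1 := (even_sum_defect_and_le_two_of_reachable hM hN x).1
    rw [sum_eq_single x, hx] at h1
    · exact absurd h1 (by decide)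
    · exact fun y hy hyx => hcon y hyx (mem_filter.1 hy).2
    · exact fun hx' => absurd (mem_filter.2 ⟨mem_univ _, .refl _⟩) hx'
  have hnb := not_third b hab hbc.symm hb
  have hnd := not_third d had hcd hd
  obtain ⟨P₁, hP₁⟩ := exists_path_of_reachable hle hreach
  have disj_of : ∀ {x y : V} (P : G.Path x y), (∀ z ∈ P.1.support, U.Reachable x z) →
      ¬ U.Reachable a x → P₁.1.support.Disjoint P.1.support := fun P hP hx z hz hz' =>
    hx ((hP₁ z hz).trans (hP z hz').symm)
  have hnbd : ¬ U.Reachable b d := fun h => by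
    obtain ⟨P, hP⟩ := exists_path_of_reachable hle h
    exact hplane P₁.1 P.1 (disj_of P hP hnb)
  obtain ⟨s, hsb, hbs, hs⟩ := other_end b hb
  obtain ⟨t, htd, hdt, ht⟩ := other_end d hd
  -- The other ends avoid a and c, which lie in a different component, so only S can contain them.
  have mem_S : ∀ x, (U.Reachable b x ∨ U.Reachable d x) → x ≠ b → x ≠ d → defect M N x ≠ 0 →
      x ∈ S := by
    intro x hx hxb hxd hx0
    by_contra hxS
    refine hx0 (h0 x hxS ?_ hxb ?_ hxd)
    · rintro rfl; exact hx.elim (fun h => hnb h.symm) fun h => hnd h.symm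
    · rintro rfl
      exact hx.elim (fun h => hnb (hreach.trans h.symm)) fun h => hnd (hreach.trans h.symm)
  have hsS := mem_S s (Or.inl hbs) hsb (fun h => hnbd (h ▸ hbs)) hs
  have htS := mem_S t (Or.inr hdt) (fun h => hnbd (h ▸ hdt).symm) htd ht
  obtain ⟨P₂, hP₂⟩ := exists_path_of_reachable hle hbs
  obtain ⟨P₃, hP₃⟩ := exists_path_of_reachable hle hdt
  refine hsep ⟨s, hsS, t, htS, ?_, P₁, P₂, P₃, disj_of P₂ hP₂ hnb, disj_of P₃ hP₃ hnd, ?_⟩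
  · rintro rfl
    exact hnbd (hbs.trans hdt.symm)
  · exact fun z hz hz' => hnbd ((hP₂ z hz).trans (hP₃ z hz').symm)

/-! ### Exchanging two matchings on a union of components. -/

/-- The subgraph that agrees with `N` on `K` and with `M` outside of `K`. -/
def splice (K : Set V) (M N : G.Subgraph) : G.Subgraph where
  verts := {v | (v ∈ K ∧ v ∈ N.verts) ∨ (v ∉ K ∧ v ∈ M.verts)}
  Adj x y := (x ∈ K ∧ y ∈ K ∧ N.Adj x y) ∨ (x ∉ K ∧ y ∉ K ∧ M.Adj x y)
  adj_sub := by
    rintro x y (⟨-, -, h⟩ | ⟨-, -, h⟩) <;> exact h.adj_sub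
  edge_vert := by
    rintro x y (⟨hx, -, h⟩ | ⟨hx, -, h⟩)
    · exact Or.inl ⟨hx, N.edge_vert h⟩
    · exact Or.inr ⟨hx, M.edge_vert h⟩
  symm := ⟨by
    rintro x y (⟨hx, hy, h⟩ | ⟨hx, hy, h⟩)
    · exact Or.inl ⟨hy, hx, h.symm⟩
    · exact Or.inr ⟨hy, hx, h.symm⟩⟩

variable {K : Set V} {M N : G.Subgraph}

lemma mem_splice_of_mem {v : V} (hv : v ∈ K) : v ∈ (splice K M N).verts ↔ v ∈ N.verts := by
  simp [splice, hv]

lemma mem_splice_of_notMem {v : V} (hv : v ∉ K) : v ∈ (splice K M N).verts ↔ v ∈ M.verts := by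
  simp [splice, hv]

/-- `K` is a union of components of the graph `U`. -/
def IsComponentUnion (U : SimpleGraph V) (K : Set V) : Prop := ∀ x y, U.Adj x y → (x ∈ K ↔ y ∈ K)

lemma superpose_comm (M N : G.Subgraph) : superpose M N = superpose N M := sup_comm _ _

/-- No edge of either subgraph leaves `K`, so testing one endpoint suffices. -/
lemma splice_adj (hK : IsComponentUnion (superpose M N) K) {x y : V} :
    (splice K M N).Adj x y ↔ (x ∈ K ∧ N.Adj x y) ∨ (x ∉ K ∧ M.Adj x y) := by
  have h1 := hK x y
  simp only [superpose_adj] at h1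
  simp only [splice]
  tauto

lemma superpose_splice (hK : IsComponentUnion (superpose M N) K) :
    superpose (splice K M N) (splice K N M) = superpose M N := by
  ext x y
  have hK' := hK
  rw [superpose_comm] at hK'
  rw [superpose_adj, superpose_adj, splice_adj hK, splice_adj hK']
  tauto

lemma splice_splice (hK : IsComponentUnion (superpose M N) K) :
    splice K (splice K M N) (splice K N M) = M := by
  have hK' := hK
  rw [superpose_comm] at hK'
  have hK'' : IsComponentUnion (superpose (splice K M N) (splice K N M)) K := by
    rwa [superpose_splice hK]
  apply Subgraph.ext
  · ext v
    by_cases hv : v ∈ K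
    · rw [mem_splice_of_mem hv, mem_splice_of_mem hv]
    · rw [mem_splice_of_notMem hv, mem_splice_of_notMem hv]
  · ext x y
    rw [splice_adj hK'', splice_adj hK, splice_adj hK']
    tauto

lemma isMatching_splice (hK : IsComponentUnion (superpose M N) K) (hM : M.IsMatching)
    (hN : N.IsMatching) : (splice K M N).IsMatching := by
  intro v hv
  by_cases hvK : v ∈ K
  · obtain ⟨w, hw, huniq⟩ := hN ((mem_splice_of_mem hvK).1 hv)
    exact ⟨w, (splice_adj hK).2 (Or.inl ⟨hvK, hw⟩), fun y hy => huniq y (by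
      have := (splice_adj hK).1 hy; tauto)⟩
  · obtain ⟨w, hw, huniq⟩ := hM ((mem_splice_of_notMem hvK).1 hv)
    exact ⟨w, (splice_adj hK).2 (Or.inr ⟨hvK, hw⟩), fun y hy => huniq y (by
      have := (splice_adj hK).1 hy; tauto)⟩

lemma defect_splice (v : V) : defect (splice K M N) (splice K N M) v = defect M N v := by
  unfold defect
  by_cases hv : v ∈ K
  · have h1 := mem_splice_of_mem (M := M) (N := N) hv
    have h2 := mem_splice_of_mem (M := N) (N := M) hv
    by_cases hM : v ∈ M.verts <;> by_cases hN : v ∈ N.verts <;> simp [h1, h2, hM, hN]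
  · have h1 := mem_splice_of_notMem (M := M) (N := N) hv
    have h2 := mem_splice_of_notMem (M := N) (N := M) hv
    by_cases hM : v ∈ M.verts <;> by_cases hN : v ∈ N.verts <;> simp [h1, h2, hM, hN]

/-- The edges meeting `K` change factors and all others stay, so the product of all weights is the
same. -/
lemma matchingWeight_splice_mul [Finite V] {R : Type*} [CommRing R] (w : Sym2 V → R)
    (hK : IsComponentUnion (superpose M N) K) :
    matchingWeight w (splice K M N) * matchingWeight w (splice K N M) =
      matchingWeight w M * matchingWeight w N := by
  set E : Set (Sym2 V) := {e | ∃ x ∈ e, x ∈ K}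
  have key : ∀ {M N : G.Subgraph}, IsComponentUnion (superpose M N) K →
      matchingWeight w (splice K M N) =
        (∏ᶠ e ∈ N.edgeSet ∩ E, w e) * ∏ᶠ e ∈ M.edgeSet \ E, w e := by
    intro M N hK
    have hset : (splice K M N).edgeSet = (N.edgeSet ∩ E) ∪ (M.edgeSet \ E) := by
      ext e
      induction e with | _ x y => ?_
      have h1 := hK x y
      simp only [superpose_adj] at h1
      simp only [Subgraph.mem_edgeSet, splice_adj hK, Set.mem_union, Set.mem_inter_iff,
        Set.mem_sdiff, E, Set.mem_ofPred_eq, Sym2.mem_iff, exists_eq_or_imp, exists_eq_left]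
      tauto
    rw [matchingWeight, hset, finprod_mem_union _ (Set.toFinite _) (Set.toFinite _)]
    exact Set.disjoint_left.2 fun e he he' => he'.2 he.2
  rw [key hK, key (superpose_comm M N ▸ hK), matchingWeight, matchingWeight,
    ← finprod_mem_inter_mul_sdiff E (s := M.edgeSet) (Set.toFinite _),
    ← finprod_mem_inter_mul_sdiff E (s := N.edgeSet) (Set.toFinite _)]
  ring

/-- A union of components containing `a`, exactly one of `b` and `d`, and not `c`, provided that
`a` and `c` as well as `b` and `d` are in different components. -/
noncomputable def flipSet (U : SimpleGraph V) (a b c d : V) : Set V :=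
  open Classical in
  if U.Reachable a b ∨ U.Reachable a d then {x | U.Reachable a x}
  else if U.Reachable b c then {x | U.Reachable a x ∨ U.Reachable d x}
  else {x | U.Reachable a x ∨ U.Reachable b x}

lemma isComponentUnion_flipSet (U : SimpleGraph V) (a b c d : V) :
    IsComponentUnion U (flipSet U a b c d) := by
  intro x y hxy
  have h : ∀ z, U.Reachable z x ↔ U.Reachable z y := fun z =>
    ⟨fun h => h.trans hxy.reachable, fun h => h.trans hxy.symm.reachable⟩
  unfold flipSet
  split_ifs <;> simp [h]

lemma mem_flipSet_self (U : SimpleGraph V) (a b c d : V) : a ∈ flipSet U a b c d := by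
  unfold flipSet
  split_ifs <;> simp

/-- If b is joined to c, the set uses d instead; d is then not joined to c, since b and d are
separate. -/
lemma notMem_flipSet {U : SimpleGraph V} {a b c d : V} (hac : ¬ U.Reachable a c)
    (hbd : ¬ U.Reachable b d) : c ∉ flipSet U a b c d := by
  unfold flipSet
  split_ifs with h1 h2
  · simpa
  · simp only [Set.mem_ofPred_eq, not_or]
    exact ⟨hac, fun h => hbd (h2.trans h.symm)⟩
  · simp only [Set.mem_ofPred_eq, not_or]
    exact ⟨hac, h2⟩

lemma mem_flipSet_iff_notMem {U : SimpleGraph V} {a b c d : V}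
    (hbd : ¬ U.Reachable b d) : b ∈ flipSet U a b c d ↔ d ∉ flipSet U a b c d := by
  unfold flipSet
  split_ifs with h1 h2
  · simp only [Set.mem_ofPred_eq]
    exact ⟨fun h h' => hbd (h.symm.trans h'), fun h => h1.resolve_right h⟩
  · rw [not_or] at h1
    simp only [Set.mem_ofPred_eq, h1, SimpleGraph.Reachable.refl, or_true, not_true, iff_false,
      false_or]
    exact fun h => hbd h.symm
  · rw [not_or] at h1
    simp [h1, hbd]

end Superposition

/-! ### Pairs of matchings and the condensation identities. -/

section Condensation

variable {V R : Type*} [CommRing R] {G : SimpleGraph V}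

/-- The pairs of matchings such that every vertex of `Q` is covered exactly once, and every vertex
outside `S` and `Q` is covered twice. -/
structure IsFreePair (S Q : Set V) (p : G.Subgraph × G.Subgraph) : Prop where
  fst : p.1.IsMatching
  snd : p.2.IsMatching
  defect_one : ∀ v ∈ Q, defect p.1 p.2 v = 1
  defect_zero : ∀ v, v ∉ S → v ∉ Q → defect p.1 p.2 v = 0

/-- The total weight of the free pairs with the property `P`. -/
noncomputable def pairSum (w : Sym2 V → R) (S Q : Set V) (P : G.Subgraph × G.Subgraph → Prop) : R :=
  ∑ᶠ p ∈ {p | IsFreePair S Q p ∧ P p}, matchingWeight w p.1 * matchingWeight w p.2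

lemma pairSum_add [Finite V] (w : Sym2 V → R) {S Q : Set V} {P₁ P₂ : G.Subgraph × G.Subgraph → Prop}
    (h : ∀ p, P₁ p → ¬ P₂ p) :
    pairSum w S Q P₁ + pairSum w S Q P₂ = pairSum w S Q fun p => P₁ p ∨ P₂ p := by
  rw [pairSum, pairSum, pairSum, ← finsum_mem_union _ (Set.toFinite _) (Set.toFinite _)]
  · refine finsum_mem_congr (Set.ext fun p => ?_) fun _ _ => rfl
    simp only [Set.mem_union, Set.mem_ofPred_eq]
    tauto
  · exact Set.disjoint_left.2 fun p hp hp' => h p hp.2 hp'.2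

lemma pairSum_congr (w : Sym2 V → R) {S Q : Set V} {P₁ P₂ : G.Subgraph × G.Subgraph → Prop}
    (h : ∀ p, P₁ p ↔ P₂ p) : pairSum w S Q P₁ = pairSum w S Q P₂ := by
  rw [funext fun p => propext (h p)]

lemma mem_freeMatchings_iff {S X : Set V} {M : G.Subgraph} :
    (M ≤ del G X ∧ M.IsMatching ∧ (del G X).verts \ S ⊆ M.verts) ↔
      M.IsMatching ∧ (∀ v ∈ M.verts, v ∉ X) ∧ ∀ v, v ∉ X → v ∉ S → v ∈ M.verts := by
  constructor
  · rintro ⟨hle, hM, hc⟩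
    exact ⟨hM, fun v hv => (hle.1 hv).2, fun v hX hS => hc ⟨⟨trivial, hX⟩, hS⟩⟩
  · rintro ⟨hM, hX, hc⟩
    refine ⟨⟨fun v hv => ⟨trivial, hX v hv⟩, fun x y h => ?_⟩, hM, fun v hv => hc v hv.1.2 hv.2⟩
    simp only [del, Subgraph.deleteVerts_adj, Subgraph.verts_top, Set.mem_univ, true_and,
      Subgraph.top_adj]
    exact ⟨hX x (M.edge_vert h), hX y (M.edge_vert h.symm), h.adj_sub⟩

/-- A product of two free boundary matching sums with complementary deletions in `Q`. -/
lemma freeMatchingSum_mul [Finite V] (w : Sym2 V → R) {S Q X Y : Set V} (hSQ : Disjoint S Q)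
    (hX : X ⊆ Q) (hY : Y = Q \ X) :
    freeMatchingSum w S (del G X) * freeMatchingSum w S (del G Y) =
      pairSum (G := G) w S Q fun p => ∀ v ∈ Q, v ∈ p.1.verts ↔ v ∉ X := by
  classical
  have := Fintype.ofFinite G.Subgraph
  simp only [freeMatchingSum, pairSum]
  rw [finsum_mem_eq_finite_toFinset_sum _ (Set.toFinite _),
    finsum_mem_eq_finite_toFinset_sum _ (Set.toFinite _),
    finsum_mem_eq_finite_toFinset_sum _ (Set.toFinite _), sum_mul_sum, ← sum_product']
  refine sum_congr ?_ fun _ _ => rfl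
  ext ⟨M, N⟩
  simp only [mem_product, Set.Finite.mem_toFinset, Set.mem_ofPred_eq, mem_freeMatchings_iff]
  subst hY
  have hS : ∀ v ∈ Q, v ∉ S := fun v hv hv' => Set.disjoint_left.1 hSQ hv' hv
  constructor
  · rintro ⟨⟨hM, hMX, hMc⟩, hN, hNX, hNc⟩
    -- A vertex of `Q` is outside `S`, hence must be matched unless deleted; it is deleted from
    -- exactly one of the two factors.
    have hMQ : ∀ v ∈ Q, v ∈ M.verts ↔ v ∉ X := fun v hv => ⟨hMX v, fun h => hMc v h (hS v hv)⟩
    refine ⟨⟨hM, hN, fun v hv => defect_eq_one.2 ((hMQ v hv).trans (not_congr ⟨?_, ?_⟩)),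
      fun v hvS hvQ => defect_eq_zero.2 ⟨hMc v (fun h => hvQ (hX h)) hvS,
        hNc v (fun h => hvQ h.1) hvS⟩⟩, hMQ⟩
    · exact fun h => hNc v (fun h' => h'.2 h) (hS v hv)
    · exact fun h => by_contra fun h' => hNX v h ⟨hv, h'⟩
  · rintro ⟨⟨hM, hN, h1, h0⟩, hMQ⟩
    have hNQ : ∀ v ∈ Q, v ∈ N.verts ↔ v ∈ X := fun v hv => by
      have := defect_eq_one.1 (h1 v hv)
      have := hMQ v hv
      tauto
    refine ⟨⟨hM, fun v hv hvX => (hMQ v (hX hvX)).1 hv hvX, fun v hvX hvS => ?_⟩, hN,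
      fun v hv hvX => hvX.2 ((hNQ v hvX.1).1 hv), fun v hvX hvS => ?_⟩
    · by_cases hvQ : v ∈ Q
      · exact (hMQ v hvQ).2 hvX
      · exact (defect_eq_zero.1 (h0 v hvS hvQ)).1
    · by_cases hvQ : v ∈ Q
      · exact (hNQ v hvQ).2 (by_contra fun h => hvX ⟨hvQ, h⟩)
      · exact (defect_eq_zero.1 (h0 v hvS hvQ)).2

/-- Exchange the two subgraphs on the flip set of their superposition. -/
noncomputable def flipPair (a b c d : V) (p : G.Subgraph × G.Subgraph) :
    G.Subgraph × G.Subgraph :=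
  (splice (flipSet (superpose p.1 p.2) a b c d) p.1 p.2,
    splice (flipSet (superpose p.1 p.2) a b c d) p.2 p.1)

lemma superpose_flipPair (a b c d : V) (p : G.Subgraph × G.Subgraph) :
    superpose (flipPair a b c d p).1 (flipPair a b c d p).2 = superpose p.1 p.2 :=
  superpose_splice (isComponentUnion_flipSet _ _ _ _ _)

/-- The flip set depends only on the superposition, which the exchange preserves, so the second
exchange uses the same set. -/
lemma flipPair_flipPair (a b c d : V) (p : G.Subgraph × G.Subgraph) :
    flipPair a b c d (flipPair a b c d p) = p := by
  have hK := isComponentUnion_flipSet (superpose p.1 p.2) a b c d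
  rw [flipPair, superpose_flipPair]
  exact Prod.ext (splice_splice hK) (splice_splice (superpose_comm p.1 p.2 ▸ hK))

lemma IsFreePair.flipPair {S Q : Set V} (a b c d : V) {p : G.Subgraph × G.Subgraph}
    (hp : IsFreePair S Q p) : IsFreePair S Q (flipPair a b c d p) := by
  have hK := isComponentUnion_flipSet (superpose p.1 p.2) a b c d
  refine ⟨isMatching_splice hK hp.fst hp.snd,
    isMatching_splice (superpose_comm p.1 p.2 ▸ hK) hp.snd hp.fst, fun v hv => ?_,
    fun v hvS hvQ => ?_⟩
  · exact (defect_splice v).trans (hp.defect_one v hv)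
  · exact (defect_splice v).trans (hp.defect_zero v hvS hvQ)

lemma matchingWeight_flipPair [Finite V] (w : Sym2 V → R) (a b c d : V) (p : G.Subgraph × G.Subgraph) :
    matchingWeight w (flipPair a b c d p).1 * matchingWeight w (flipPair a b c d p).2 =
      matchingWeight w p.1 * matchingWeight w p.2 :=
  matchingWeight_splice_mul w (isComponentUnion_flipSet _ _ _ _ _)

lemma IsFreePair.mem_flipPair_of_mem {S Q : Set V} {a b c d : V} {p : G.Subgraph × G.Subgraph}
    (hp : IsFreePair S Q p) {v : V} (hv : v ∈ Q)
    (hK : v ∈ flipSet (superpose p.1 p.2) a b c d) :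
    v ∈ (FreeBoundary.flipPair a b c d p).1.verts ↔ v ∉ p.1.verts := by
  have := defect_eq_one.1 (hp.defect_one v hv)
  rw [FreeBoundary.flipPair, mem_splice_of_mem hK]
  tauto

/-- The exchange toggles `a` and exactly one of `b` and `d`, so it matches the pairs of one kind with
those of another kind. -/
lemma pairSum_flip [Finite V] (w : Sym2 V → R) {S : Set V} {a b c d : V}
    (hab : a ≠ b) (hac : a ≠ c) (had : a ≠ d) (hbc : b ≠ c) (hbd : b ≠ d) (hcd : c ≠ d)
    (hplane : ∀ (p : G.Walk a c) (q : G.Walk b d), ¬ p.support.Disjoint q.support)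
    (hsac : IsSeparated G S a b c d) (hsbd : IsSeparated G S b c d a) (s : Prop) :
    pairSum (G := G) w S {a, b, c, d} (fun p => a ∈ p.1.verts ∧ c ∈ p.1.verts ∧
        ((b ∈ p.1.verts ↔ d ∈ p.1.verts) ↔ s)) =
      pairSum (G := G) w S {a, b, c, d} (fun p => a ∉ p.1.verts ∧ c ∈ p.1.verts ∧
        ¬ ((b ∈ p.1.verts ↔ d ∈ p.1.verts) ↔ s)) := by
  have hplane' : ∀ (p : G.Walk b d) (q : G.Walk c a), ¬ p.support.Disjoint q.support :=
    fun p q h => hplane q.reverse p (by simpa using h.symm)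
  have toggle : ∀ p : G.Subgraph × G.Subgraph, IsFreePair S {a, b, c, d} p →
      (a ∈ (flipPair a b c d p).1.verts ↔ a ∉ p.1.verts) ∧
      (c ∈ (flipPair a b c d p).1.verts ↔ c ∈ p.1.verts) ∧
      ((b ∈ (flipPair a b c d p).1.verts ↔ d ∈ (flipPair a b c d p).1.verts) ↔
        ¬ (b ∈ p.1.verts ↔ d ∈ p.1.verts)) := by
    intro p hp
    have ha := hp.defect_one a (by simp)
    have hb := hp.defect_one b (by simp)
    have hc := hp.defect_one c (by simp)
    have hd := hp.defect_one d (by simp)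
    have hrac := not_reachable_opposite hp.fst hp.snd hab hac had hbc hcd ha hb hc hd
      (fun v hv h1 h2 h3 h4 => hp.defect_zero v hv (by simp [*])) hplane hsac
    -- The same argument for the rotated order b, c, d, a.
    have hrbd := not_reachable_opposite hp.fst hp.snd hbc hbd hab.symm hcd had.symm hb hc hd ha
      (fun v hv h1 h2 h3 h4 => hp.defect_zero v hv (by simp [*])) hplane' hsbd
    refine ⟨hp.mem_flipPair_of_mem (by simp) (mem_flipSet_self _ _ _ _ _),
      mem_splice_of_notMem (notMem_flipSet hrac hrbd), ?_⟩
    have hiff := mem_flipSet_iff_notMem (a := a) (c := c) hrbd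
    by_cases hbK : b ∈ flipSet (superpose p.1 p.2) a b c d
    · rw [hp.mem_flipPair_of_mem (by simp) hbK, flipPair, mem_splice_of_notMem (hiff.1 hbK)]
      tauto
    · rw [hp.mem_flipPair_of_mem (v := d) (by simp) (by tauto), flipPair, mem_splice_of_notMem hbK]
      tauto
  refine finsum_mem_eq_of_bijOn (flipPair a b c d)
    (Set.InvOn.bijOn (f' := flipPair a b c d)
      ⟨fun p _ => flipPair_flipPair a b c d p, fun p _ => flipPair_flipPair a b c d p⟩ ?_ ?_)
    fun p _ => (matchingWeight_flipPair w a b c d p).symm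
  · rintro p ⟨hp, h⟩
    obtain ⟨h1, h2, h3⟩ := toggle p hp
    refine ⟨hp.flipPair a b c d, ?_⟩
    dsimp only at h ⊢
    rw [h1, h2, h3]
    tauto
  · rintro p ⟨hp, h⟩
    obtain ⟨h1, h2, h3⟩ := toggle p hp
    refine ⟨hp.flipPair a b c d, ?_⟩
    dsimp only at h ⊢
    rw [h1, h2, h3]
    tauto

lemma freeMatchingSum_empty (w : Sym2 V → R) (H : G.Subgraph) :
    freeMatchingSum w ∅ H = perfectMatchingSum w H := by
  unfold freeMatchingSum perfectMatchingSum
  refine finsum_mem_congr (Set.ext fun M => ?_) fun _ _ => rfl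
  simp only [Set.mem_ofPred_eq, Set.sdiff_empty]
  exact ⟨fun ⟨h1, h2, h3⟩ => ⟨h1, h2, h1.1.antisymm h3⟩, fun ⟨h1, h2, h3⟩ => ⟨h1, h2, h3.ge⟩⟩

lemma freeMatchingSum_mul_of_four [Finite V] (w : Sym2 V → R) {S X Y : Set V} {a b c d : V}
    (hS : Disjoint S {a, b, c, d}) (hXY : ∀ v, (v = a ∨ v = b ∨ v = c ∨ v = d) ↔ v ∈ X ∨ v ∈ Y)
    (hdisj : ∀ v ∈ X, v ∉ Y) :
    freeMatchingSum w S (del G X) * freeMatchingSum w S (del G Y) =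
      pairSum (G := G) w S {a, b, c, d} fun p => (a ∈ p.1.verts ↔ a ∉ X) ∧
        (b ∈ p.1.verts ↔ b ∉ X) ∧ (c ∈ p.1.verts ↔ c ∉ X) ∧ (d ∈ p.1.verts ↔ d ∉ X) := by
  have hX : X ⊆ {a, b, c, d} := fun v hv => (hXY v).2 (Or.inl hv)
  have hY : Y = {a, b, c, d} \ X := Set.ext fun v =>
    ⟨fun hv => ⟨(hXY v).2 (Or.inr hv), fun h => hdisj v h hv⟩,
      fun hv => ((hXY v).1 hv.1).resolve_left hv.2⟩
  rw [freeMatchingSum_mul w hS hX hY]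
  exact pairSum_congr w fun p => by
    simp only [Set.mem_insert_iff, Set.mem_singleton_iff, forall_eq_or_imp, forall_eq]

/-- The two condensation identities, for any graph in which walks joining the opposite vertices
among `a, b, c, d` intersect. -/
theorem condensation [Finite V] (w : Sym2 V → R) {S : Set V} {a b c d : V}
    (hab : a ≠ b) (hac : a ≠ c) (had : a ≠ d) (hbc : b ≠ c) (hbd : b ≠ d) (hcd : c ≠ d)
    (hS : Disjoint S {a, b, c, d})
    (hplane : ∀ (p : G.Walk a c) (q : G.Walk b d), ¬ p.support.Disjoint q.support)
    (hsac : IsSeparated G S a b c d) (hsbd : IsSeparated G S b c d a) :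
    let Mf : Set V → R := fun X => freeMatchingSum w S (del G X)
    (Mf ∅ * Mf {a, b, c, d} + Mf {b, d} * Mf {a, c}
        = Mf {a, d} * Mf {b, c} + Mf {a, b} * Mf {c, d}) ∧
    (Mf {b} * Mf {a, c, d} + Mf {d} * Mf {a, b, c}
        = Mf {a} * Mf {b, c, d} + Mf {a, b, d} * Mf {c}) := by
  intro Mf
  have hmul : ∀ X Y : Set V, (∀ v, (v = a ∨ v = b ∨ v = c ∨ v = d) ↔ v ∈ X ∨ v ∈ Y) →
      (∀ v ∈ X, v ∉ Y) → Mf X * Mf Y = _ := fun X Y => freeMatchingSum_mul_of_four w hS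
  have hflip := pairSum_flip w hab hac had hbc hbd hcd hplane hsac hsbd
  constructor
  · rw [hmul ∅ {a, b, c, d} ?_ ?_, hmul {b, d} {a, c} ?_ ?_, hmul {a, d} {b, c} ?_ ?_,
      hmul {a, b} {c, d} ?_ ?_, pairSum_add, pairSum_add]
    -- On the left the first matching covers a and c, and both or neither of b and d; on the right
    -- it covers c, not a, and exactly one of b and d.
    · convert hflip True using 1 <;> refine pairSum_congr w fun p => ?_ <;>
        by_cases hb : b ∈ p.1.verts <;> by_cases hd : d ∈ p.1.verts <;>
        simp [hb, hd, hab, had, hbd, hcd, hab.symm, hac.symm, had.symm, hbc.symm, hbd.symm]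
    all_goals clear hmul hflip hplane hsac hsbd hS; grind
  · rw [hmul {b} {a, c, d} ?_ ?_, hmul {d} {a, b, c} ?_ ?_, hmul {a} {b, c, d} ?_ ?_,
      hmul {a, b, d} {c} ?_ ?_, pairSum_add, pairSum_add]
    -- Here the left has exactly one of b and d covered by the first matching, and the right both or
    -- neither.
    · convert hflip False using 1 <;> refine pairSum_congr w fun p => ?_ <;>
        by_cases hb : b ∈ p.1.verts <;> by_cases hd : d ∈ p.1.verts <;>
        simp [hb, hd, hab, had, hbd, hcd, hab.symm, hac.symm, had.symm, hbc.symm, hbd.symm]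
    all_goals clear hmul hflip hplane hsac hsbd hS; grind

end Condensation

end FreeBoundary

theorem corollary2p2 {V R : Type*} [Finite V] [CommRing R] (G : SimpleGraph V)
    (D : FreeBoundary.PlaneDrawing G) (w : Sym2 V → R)
    (F : Set ℂ) (hF : D.IsFace F)
    (a b c d : V) (habcd : D.CyclicOnFace F a b c d)
    (S : Set V) (hSF : ∀ v ∈ S, D.OnFace F v)
    (hS : Disjoint S {a, b, c, d})
    (hac : FreeBoundary.IsSeparated G S a b c d)
    (hbd : FreeBoundary.IsSeparated G S b c d a) :
    let Mf : Set V → R := fun X => FreeBoundary.freeMatchingSum w S (FreeBoundary.del G X)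
    let M : Set V → R := fun X => FreeBoundary.perfectMatchingSum w (FreeBoundary.del G X)
    (Mf ∅ * Mf {a, b, c, d} + Mf {b, d} * Mf {a, c}
        = Mf {a, d} * Mf {b, c} + Mf {a, b} * Mf {c, d}) ∧
    (Mf {b} * Mf {a, c, d} + Mf {d} * Mf {a, b, c}
        = Mf {a} * Mf {b, c, d} + Mf {a, b, d} * Mf {c}) ∧
    (S = ∅ →
      (M ∅ * M {a, b, c, d} + M {b, d} * M {a, c}
        = M {a, d} * M {b, c} + M {a, b} * M {c, d}) ∧
      (M {b} * M {a, c, d} + M {d} * M {a, b, c}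
        = M {a} * M {b, c, d} + M {a, b, d} * M {c})) := by
  intro Mf M
  obtain ⟨hab, nac, had, hbc, nbd, hcd⟩ :
      a ≠ b ∧ a ≠ c ∧ a ≠ d ∧ b ≠ c ∧ b ≠ d ∧ c ≠ d := by
    obtain ⟨h, -, hi, -, ha, hb, hc, hd⟩ := habcd
    -- The four vertices are distinct because `h` is injective on the disc and 1, i, -1, -i are
    -- distinct.
    have key : ∀ {z z' : ℂ} {x y : V}, h z = D.pos x → h z' = D.pos y → ‖z‖ ≤ 1 → ‖z'‖ ≤ 1 →
        z ≠ z' → x ≠ y := by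
      rintro z z' x y hx hy hz hz' hne rfl
      exact hne (hi (by simpa using hz) (by simpa using hz') (hx.trans hy.symm))
    refine ⟨key ha hb ?_ ?_ ?_, key ha hc ?_ ?_ ?_, key ha hd ?_ ?_ ?_, key hb hc ?_ ?_ ?_,
      key hb hd ?_ ?_ ?_, key hc hd ?_ ?_ ?_⟩ <;> norm_num [Complex.ext_iff]
  have hplane := fun (p : G.Walk a c) (q : G.Walk b d) => habcd.walks_intersect hF p q
  have hMf := FreeBoundary.condensation w hab nac had hbc nbd hcd hS hplane hac hbd
  refine ⟨hMf.1, hMf.2, ?_⟩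
  rintro rfl
  simpa only [Mf, M, FreeBoundary.freeMatchingSum_empty] using hMf
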